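/- Let $r\ge 1$ be an integer. A nonempty simplicial complex $X$ (finite or infinite) with vertex set $V(X)$ is *$r$-ample* if for each subset $U\subseteq V(X)$ with $|U|\le r$ and each (possibly empty) subcomplex $A$ of the induced subcomplex $X_U$ there is a vertex $v\in V(X)\setminus U$ such that $\mathrm{lk}_X(v)\cap X_U=A$. A simplicial loop with $n\ge 3$ vertexes in a complex $Y$ is a simplicial map $\alpha:S^1\to Y$, where $S^1$ is the circle triangulated as the $n$-gon. It *bounds a simplicial disc* $\beta:D^2\to Y$ if $D^2$ is a triangulation of the closed disc whose boundary is this $n$-gon (so that it has exactly $n$ boundary vertexes) and $\beta$ is a simplicial map extending $\alpha$. A nonempty complex $Y$ is *simply connected* if any two of its vertexes are joined by an edge path and every simplicial loop in $Y$ bounds a simplicial disc. **Proposition 4.1.** For $r\ge 4$, every $r$-ample simplicial complex $Y$ is simply connected. Moreover, for every $n\ge 3$, every simplicial loop $\alpha:S^1\to Y$ with $n$ vertexes bounds a simplicial disc $\beta: D^2\to Y$, where $D^2$ is a triangulation of the disc having $n$ boundary vertexes, at most $k$ internal vertexes and at most $k(r-1)+1$ triangles, where $k=\max\left\{1,\left\lceil\frac{n-3}{r-3}\right\rceil\right\}$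 (so $k=\left\lceil\frac{n-3}{r-3}\right\rceil$ whenever $n\ge 4$). -/

import Mathlib

namespace AmpleComplex

/-- The induced subcomplex `X_U`: its simplexes are the simplexes of `X` contained in `U`. -/
def induced {V : Type*} (X : AbstractSimplicialComplex V) (U : Finset V) :
    PreAbstractSimplicialComplex V where
  faces := {s | s ∈ X.faces ∧ s ⊆ U}
  isRelLowerSet_faces := fun _ hs =>
    ⟨(X.isRelLowerSet_faces hs.1).1, fun _ hts ht =>
      ⟨(X.isRelLowerSet_faces hs.1).2 hts ht, hts.trans hs.2⟩⟩

/-- The link of a vertex `v`: all simplexes `σ` not containing `v` such that `σ ∪ {v}` is a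
simplex. -/
def link {V : Type*} [DecidableEq V] (X : AbstractSimplicialComplex V) (v : V) :
    PreAbstractSimplicialComplex V where
  faces := {s | s.Nonempty ∧ v ∉ s ∧ insert v s ∈ X.faces}
  isRelLowerSet_faces := fun _ hs =>
    ⟨hs.1, fun _ hts ht => ⟨ht, fun hv => hs.2.1 (hts hv),
      (X.isRelLowerSet_faces hs.2.2).2 (Finset.insert_subset_insert v hts)
        (Finset.insert_nonempty _ _)⟩⟩

/-- `r`-ampleness (`r ≥ 1`) of a nonempty simplicial complex `X` with vertex set `V`: for every set
`U` of at most `r` vertices and every (possibly empty) subcomplex `A` of `X_U` there is a vertex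
`v` outside `U` with `lk_X(v) ∩ X_U = A`. -/
def IsAmple {V : Type*} [DecidableEq V] (r : ℕ) (X : AbstractSimplicialComplex V) : Prop :=
  1 ≤ r ∧ Nonempty V ∧
    ∀ U : Finset V, U.card ≤ r → ∀ A : PreAbstractSimplicialComplex V, A ≤ induced X U →
      ∃ v : V, v ∉ U ∧ link X v ⊓ induced X U = A

/-- Simplicial maps: vertex maps taking simplexes to simplexes (possibly of smaller dimension). -/
def IsSimplicialMap {W V : Type*} [DecidableEq V] (K : AbstractSimplicialComplex W)
    (L : AbstractSimplicialComplex V) (f : W → V) : Prop :=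
  ∀ s ∈ K.faces, s.image f ∈ L.faces

/-- A simplicial loop with `n` vertices: a simplicial map to `Y` from the triangulation of the
circle with `n ≥ 3` vertices, i.e. from the `n`-gon with vertices `i : ZMod n` and edges
`{i, i + 1}`. It need not be injective, and an edge may be collapsed to a vertex. -/
def IsSimplicialLoop {V : Type*} [DecidableEq V] (Y : AbstractSimplicialComplex V) (n : ℕ)
    (α : ZMod n → V) : Prop :=
  3 ≤ n ∧ ∀ i : ZMod n, ({α i, α (i + 1)} : Finset V) ∈ Y.faces

/-- The geometric realisation of a finite simplicial complex, in barycentric coordinates. -/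
def realization {W : Type*} [Fintype W] (D : AbstractSimplicialComplex W) : Set (W → ℝ) :=
  {x | x ∈ stdSimplex ℝ W ∧ ∃ s ∈ D.faces, ∀ w, x w ≠ 0 → w ∈ s}

/-- `D` is a triangulation of the closed disc whose boundary circle is the `n`-gon with the
distinct vertices `b i` and the edges `{b i, b (i + 1)}`: there is a homeomorphism from the
geometric realisation of `D` to the closed unit disc under which exactly the points of these edges
correspond to the points of the unit circle. -/
structure IsDiscTriangulation {W : Type*} [Fintype W] [DecidableEq W]
    (D : AbstractSimplicialComplex W) (n : ℕ) (b : ZMod n → W) : Prop where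
  injective : Function.Injective b
  edge_mem : ∀ i : ZMod n, ({b i, b (i + 1)} : Finset W) ∈ D.faces
  exists_homeomorph :
    ∃ h : realization D ≃ₜ Metric.closedBall (0 : EuclideanSpace ℝ (Fin 2)) 1,
      ∀ x : realization D, ‖(h x : EuclideanSpace ℝ (Fin 2))‖ = 1 ↔
        ∃ i : ZMod n, ∀ w, (x : W → ℝ) w ≠ 0 → w = b i ∨ w = b (i + 1)

/-- The loop `α` bounds the simplicial disc `β : D → Y`: `D` is a triangulated disc with boundary
the `n`-gon `b`, and `β` is a simplicial map restricting to `α` on the boundary. -/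
def BoundsDisc {V W : Type*} [DecidableEq V] [Fintype W] [DecidableEq W]
    (Y : AbstractSimplicialComplex V) (n : ℕ) (α : ZMod n → V)
    (D : AbstractSimplicialComplex W) (b : ZMod n → W) (β : W → V) : Prop :=
  IsDiscTriangulation D n b ∧ IsSimplicialMap D Y β ∧ ∀ i, β (b i) = α i

/-- Simple connectedness (that is, 1-connectedness) of a nonempty simplicial complex: every map of
the two-point complex (a 0-sphere) extends to a triangulated interval, i.e. any two vertices are
joined by an edge path, and every simplicial loop (a map of a triangulated circle) extends to a
triangulated disc. -/
def IsSimplyConnected {V : Type*} [DecidableEq V] (Y : AbstractSimplicialComplex V) : Prop :=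
  Nonempty V ∧
  (∀ u v : V, ∃ (k : ℕ) (p : ℕ → V), p 0 = u ∧ p k = v ∧
    ∀ i < k, ({p i, p (i + 1)} : Finset V) ∈ Y.faces) ∧
  ∀ (n : ℕ) (α : ZMod n → V), IsSimplicialLoop Y n α →
    ∃ (W : Type) (_ : Fintype W) (_ : DecidableEq W) (D : AbstractSimplicialComplex W)
      (b : ZMod n → W) (β : W → V), BoundsDisc Y n α D b β

/-- The vertices of a triangulated disc that do not lie on its boundary. -/
def internalVertices {W : Type*} {n : ℕ} (b : ZMod n → W) : Set W := {w | w ∉ Set.range b}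

/-- The triangles (two-dimensional simplexes) of a complex. -/
def triangles {W : Type*} (D : AbstractSimplicialComplex W) : Set (Finset W) :=
  {s | s ∈ D.faces ∧ s.card = 3}

end AmpleComplex

/-!
The discs are built from a triangle by stellar subdivisions only. A stellar subdivision does not
change the geometric realisation: in barycentric coordinates the homeomorphism sends the new vertex
to the barycentre of the subdivided face `σ`, and its inverse subtracts from the coordinates at `σ`
their minimum (`stellarHomeomorph`). Hence subdividing a triangle of a disc gives a disc with the
same boundary polygon (`IsDisc.stellar_of_two_lt_card`), and subdividing a boundary edge gives a
disc whose polygon has one vertex more (`IsDisc.stellar_closing`). The triangle itself is a disc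
since it is a convex body in the plane (`isDisc_triangle`).

In an `r`-ample complex every set of at most `r` vertices has a cone point, adjacent to the whole
subcomplex induced on it (`IsAmple.exists_cone`). A loop with `n ≤ r` vertices is filled by the
cone over it. If `n > r`, take the cone with apex `v` over a path of `r` consecutive vertices of
the loop `a 0, …, a (n - 1)`, the path that ends at `a 0`; replacing the path by `v` and its two
ends leaves the loop `a 0, …, a (n - r + 1), v`, shorter by `r - 3`, which is filled by induction.
The path is always chosen to end at `a 0`, so that the cone point of one step is the last vertex but
one of the path coned in the next. This makes the union of the two fillings a subdivision: in the
shorter filling `v` subdivides the closing edge `{a (n - r + 1), a 0}` of a smaller disc, that edge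
lying in only one triangle. Subdividing this triangle at `v` instead, and then the closing edge at
the `r - 2` vertices that were cut off, gives the disc wanted.

The induction is thus on discs just before the last subdivision of the closing edge, whose vertex
map is simplicial except on that edge (`FanDisc`, `HasFan`, `exists_hasFan`). Each edge subdivision
adds one triangle and a boundary vertex, each triangle subdivision two triangles and an internal
vertex, so `k` cone points give `k (r - 1) + 1` triangles.
-/

namespace AmpleComplex

/-! ### Supports of points of the realisation -/

/-- The vertices at which a barycentric coordinate vector is nonzero. -/
noncomputable def supp {W : Type*} [Fintype W] (x : W → ℝ) : Finset W := by
  classical exact Finset.univ.filter fun w => x w ≠ 0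

@[simp]
theorem mem_supp {W : Type*} [Fintype W] {x : W → ℝ} {w : W} : w ∈ supp x ↔ x w ≠ 0 := by
  simp [supp]

theorem supp_nonempty {W : Type*} [Fintype W] {x : W → ℝ} (hx : x ∈ stdSimplex ℝ W) :
    (supp x).Nonempty := by
  by_contra h
  have h0 : ∀ w, x w = 0 := fun w => by
    by_contra hw
    exact h ⟨w, mem_supp.2 hw⟩
  simpa [h0] using hx.2

theorem mem_realization {W : Type*} [Fintype W] {D : AbstractSimplicialComplex W} {x : W → ℝ} :
    x ∈ realization D ↔ x ∈ stdSimplex ℝ W ∧ supp x ∈ D.faces := by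
  refine and_congr_right fun hx => ⟨?_, fun h => ⟨_, h, fun w hw => mem_supp.2 hw⟩⟩
  rintro ⟨s, hs, hsx⟩
  exact (D.isRelLowerSet_faces hs).2 (fun w hw => hsx w (mem_supp.1 hw)) (supp_nonempty hx)

/-! ### Stellar subdivision -/

/-- The carrier of a face `s` of the stellar subdivision at `σ` with new vertex `none`: the smallest
face of the original complex over which `s` lies. -/
def carrier {W : Type*} [DecidableEq W] (σ : Finset W) (s : Finset (Option W)) : Finset W :=
  s.eraseNone ∪ if none ∈ s then σ else ∅

theorem mem_carrier {W : Type*} [DecidableEq W] {σ : Finset W} {s : Finset (Option W)} {w : W} :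
    w ∈ carrier σ s ↔ some w ∈ s ∨ none ∈ s ∧ w ∈ σ := by
  by_cases h : none ∈ s <;> simp [carrier, h]

theorem carrier_mono {W : Type*} [DecidableEq W] {σ : Finset W} {s t : Finset (Option W)}
    (h : s ⊆ t) : carrier σ s ⊆ carrier σ t := fun w hw => by
  rw [mem_carrier] at hw ⊢
  exact hw.imp (fun a => h a) (fun a => ⟨h a.1, a.2⟩)

theorem carrier_nonempty {W : Type*} [DecidableEq W] {σ : Finset W} (hσ : σ.Nonempty)
    {s : Finset (Option W)} (hs : s.Nonempty) : (carrier σ s).Nonempty := by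
  obtain ⟨_ | w, h⟩ := hs
  · obtain ⟨w, hw⟩ := hσ
    exact ⟨w, mem_carrier.2 (Or.inr ⟨h, hw⟩)⟩
  · exact ⟨w, mem_carrier.2 (Or.inl h)⟩

/-- The stellar subdivision of `D` at the face `σ`, the new vertex being `none`: every face
containing `σ` is replaced by the cones from `none` over those of its faces that do not contain
`σ`. -/
def stellar {W : Type*} [DecidableEq W] (D : AbstractSimplicialComplex W) (σ : Finset W)
    (hσ : σ ∈ D.faces) (hc : 2 ≤ σ.card) : AbstractSimplicialComplex (Option W) where
  faces := {s | s.Nonempty ∧ ¬ σ ⊆ s.eraseNone ∧ carrier σ s ∈ D.faces}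
  isRelLowerSet_faces := fun s hs => ⟨hs.1, fun t hts ht =>
    ⟨ht, fun h => hs.2.1 (h.trans (Finset.eraseNone.monotone hts)),
      (D.isRelLowerSet_faces hs.2.2).2 (carrier_mono hts)
        (carrier_nonempty (D.isRelLowerSet_faces hσ).1 ht)⟩⟩
  singleton_mem := by
    have key : ∀ v : Option W, ¬ σ ⊆ ({v} : Finset (Option W)).eraseNone := fun v h => by
      have h1 := Finset.card_le_card h
      have h2 := Finset.card_eraseNone_le ({v} : Finset (Option W))
      rw [Finset.card_singleton] at h2
      omega
    rintro (_ | v)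
    · refine ⟨Finset.singleton_nonempty _, key _, ?_⟩
      simpa [carrier] using hσ
    · refine ⟨Finset.singleton_nonempty _, key _, ?_⟩
      have : carrier σ {some v} = {v} := by ext w; simp [mem_carrier]
      rw [this]
      exact D.singleton_mem v

section Homeomorph

variable {W : Type*} [Fintype W] [DecidableEq W]

/-- The linear map of barycentric coordinates that sends the new vertex to the barycentre of
`σ`. -/
noncomputable def stellarMap (σ : Finset W) (x : Option W → ℝ) (w : W) : ℝ :=
  x (some w) + if w ∈ σ then x none / σ.card else 0

/-- The inverse of `stellarMap`: the coordinates at the vertices of `σ` are lowered by their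
minimum, and what is removed becomes the coordinate at the new vertex. -/
noncomputable def stellarInv (σ : Finset W) (hσ : σ.Nonempty) (y : W → ℝ) : Option W → ℝ
  | none => σ.card * σ.inf' hσ y
  | some w => y w - if w ∈ σ then σ.inf' hσ y else 0

omit [Fintype W] in
theorem stellarMap_ne_zero_iff {σ : Finset W} {x : Option W → ℝ} (hx : ∀ w, 0 ≤ x w) (w : W) :
    stellarMap σ x w ≠ 0 ↔ x (some w) ≠ 0 ∨ x none ≠ 0 ∧ w ∈ σ := by
  have h1 := hx (some w)
  have h2 := hx none
  by_cases hw : w ∈ σ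
  · have hc : (0 : ℝ) < σ.card := by exact_mod_cast Finset.card_pos.2 ⟨w, hw⟩
    have h3 : 0 ≤ x none / σ.card := by positivity
    simp only [stellarMap, hw, if_true, and_true, ne_eq, add_eq_zero_iff_of_nonneg h1 h3,
      div_eq_zero_iff, hc.ne', or_false]
    tauto
  · simp [stellarMap, hw]

theorem supp_stellarMap {σ : Finset W} {x : Option W → ℝ} (hx : ∀ w, 0 ≤ x w) :
    supp (stellarMap σ x) = carrier σ (supp x) := by
  ext w
  rw [mem_supp, mem_carrier, mem_supp, mem_supp, stellarMap_ne_zero_iff hx]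

theorem stellarMap_mem {D : AbstractSimplicialComplex W} {σ : Finset W} {hσ : σ ∈ D.faces}
    {hc : 2 ≤ σ.card} {x : Option W → ℝ} (hx : x ∈ realization (stellar D σ hσ hc)) :
    stellarMap σ x ∈ realization D := by
  rw [mem_realization] at hx ⊢
  obtain ⟨⟨h0, h1⟩, -, -, h2⟩ := hx
  have hc' : (σ.card : ℝ) ≠ 0 := by
    have : σ.card ≠ 0 := by omega
    exact_mod_cast this
  refine ⟨⟨fun w => ?_, ?_⟩, by rwa [supp_stellarMap h0]⟩
  · have a := h0 (some w)
    have b := h0 none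
    unfold stellarMap
    split_ifs <;> positivity
  · rw [Fintype.sum_option] at h1
    simp only [stellarMap, Finset.sum_add_distrib, Finset.sum_ite_mem, Finset.univ_inter,
      Finset.sum_const, nsmul_eq_mul]
    rw [mul_div_cancel₀ _ hc']
    linarith

theorem stellarInv_mem {D : AbstractSimplicialComplex W} {σ : Finset W} {hσ : σ ∈ D.faces}
    {hc : 2 ≤ σ.card} (hne : σ.Nonempty) {y : W → ℝ} (hy : y ∈ realization D) :
    stellarInv σ hne y ∈ realization (stellar D σ hσ hc) := by
  rw [mem_realization] at hy
  obtain ⟨⟨h0, h1⟩, h2⟩ := hy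
  have hm : 0 ≤ σ.inf' hne y := Finset.le_inf' _ _ fun w _ => h0 w
  have hstd : stellarInv σ hne y ∈ stdSimplex ℝ (Option W) := by
    refine ⟨?_, ?_⟩
    · rintro (_ | w)
      · exact mul_nonneg (Nat.cast_nonneg _) hm
      · by_cases hw : w ∈ σ
        · have := Finset.inf'_le y hw
          simp only [stellarInv, hw, if_true]
          linarith
        · simpa [stellarInv, hw] using h0 w
    · rw [Fintype.sum_option]
      simp [stellarInv, Finset.sum_sub_distrib, Finset.sum_ite_mem, h1]
  rw [mem_realization]
  refine ⟨hstd, supp_nonempty hstd, fun h => ?_, ?_⟩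
  · obtain ⟨w, hw, hw'⟩ := Finset.exists_mem_eq_inf' hne y
    have := h hw
    rw [Finset.mem_eraseNone, mem_supp] at this
    simp [stellarInv, hw, hw'] at this
  · refine (D.isRelLowerSet_faces h2).2 (fun w hw => ?_)
      (carrier_nonempty hne (supp_nonempty hstd))
    rw [mem_carrier, mem_supp, mem_supp] at hw
    rw [mem_supp]
    intro hy0
    have hle : w ∈ σ → σ.inf' hne y = 0 := fun hw' =>
      le_antisymm ((Finset.inf'_le y hw').trans hy0.le) hm
    rcases hw with hw | ⟨hw, hw'⟩
    · apply hw
      by_cases hw' : w ∈ σ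
      · simp [stellarInv, hw', hy0, hle hw']
      · simp [stellarInv, hw', hy0]
    · simp [stellarInv, hle hw'] at hw

omit [Fintype W] in
theorem stellarMap_stellarInv {σ : Finset W} (hne : σ.Nonempty) (y : W → ℝ) :
    stellarMap σ (stellarInv σ hne y) = y := by
  have hc : (σ.card : ℝ) ≠ 0 := by exact_mod_cast (Finset.card_pos.2 hne).ne'
  ext w
  by_cases hw : w ∈ σ
  · simp [stellarMap, stellarInv, hw, mul_div_cancel_left₀ _ hc]
  · simp [stellarMap, stellarInv, hw]

theorem stellarInv_stellarMap {σ : Finset W} (hne : σ.Nonempty) {x : Option W → ℝ}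
    (hx : ∀ w, 0 ≤ x w) (hσ : ¬ σ ⊆ (supp x).eraseNone) :
    stellarInv σ hne (stellarMap σ x) = x := by
  have hc : (σ.card : ℝ) ≠ 0 := by exact_mod_cast (Finset.card_pos.2 hne).ne'
  -- Some vertex of `σ` has coordinate zero in `x`, so the minimum is the share of the new vertex.
  have hm : σ.inf' hne (stellarMap σ x) = x none / σ.card := by
    obtain ⟨w, hw, hw'⟩ := Finset.not_subset.1 hσ
    rw [Finset.mem_eraseNone, mem_supp, not_not] at hw'
    apply le_antisymm
    · refine (Finset.inf'_le _ hw).trans_eq ?_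
      simp [stellarMap, hw, hw']
    · refine Finset.le_inf' _ _ fun v hv => ?_
      simpa [stellarMap, hv] using hx (some v)
  ext (_ | w)
  · simp [stellarInv, hm, mul_div_cancel₀ _ hc]
  · by_cases hw : w ∈ σ
    · simp [stellarInv, hm, hw, stellarMap]
    · simp [stellarInv, hw, stellarMap]

/-- A stellar subdivision does not change the realisation up to homeomorphism. -/
noncomputable def stellarHomeomorph (D : AbstractSimplicialComplex W) (σ : Finset W)
    (hσ : σ ∈ D.faces) (hc : 2 ≤ σ.card) :
    realization (stellar D σ hσ hc) ≃ₜ realization D where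
  toFun x := ⟨stellarMap σ x, stellarMap_mem x.2⟩
  invFun y := ⟨stellarInv σ (D.isRelLowerSet_faces hσ).1 y, stellarInv_mem _ y.2⟩
  left_inv x := Subtype.ext <|
    stellarInv_stellarMap _ (mem_realization.1 x.2).1.1 (mem_realization.1 x.2).2.2.1
  right_inv y := Subtype.ext <| stellarMap_stellarInv _ _
  continuous_toFun := by
    have hx : ∀ w, Continuous fun x : realization (stellar D σ hσ hc) => (x : Option W → ℝ) w :=
      fun w => (continuous_apply w).comp continuous_subtype_val
    refine Continuous.subtype_mk (continuous_pi fun w => (hx _).add ?_) _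
    split_ifs
    · exact (hx _).div_const _
    · exact continuous_const
  continuous_invFun := by
    have hy : ∀ w, Continuous fun y : realization D => (y : W → ℝ) w :=
      fun w => (continuous_apply w).comp continuous_subtype_val
    have hm : Continuous fun y : realization D =>
        σ.inf' (D.isRelLowerSet_faces hσ).1 (y : W → ℝ) :=
      Continuous.finset_inf'_apply _ fun w _ => hy w
    refine Continuous.subtype_mk (continuous_pi fun w => ?_) _
    rcases w with _ | w
    · exact continuous_const.mul hm
    · refine (hy w).sub ?_
      split_ifs
      · exact hm
      · exact continuous_const

end Homeomorph

/-! ### Triangulated discs and their subdivisions -/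

/-- The edges of the polygon with the consecutive vertices `b 0, …, b l`. -/
def polygonEdges {W : Type*} [DecidableEq W] (l : ℕ) (b : ℕ → W) : Set (Finset W) :=
  {e | (∃ i < l, e = {b i, b (i + 1)}) ∨ e = {b l, b 0}}

/-- `D` triangulates the disc with boundary polygon `b 0, …, b l`. This is `IsDiscTriangulation`
for `n = l + 1`, the vertices being indexed by natural numbers instead of residues: an edge
subdivision then only appends a vertex at the end. -/
structure IsDisc {W : Type*} [Fintype W] [DecidableEq W] (D : AbstractSimplicialComplex W) (l : ℕ)
    (b : ℕ → W) : Prop where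
  injOn : Set.InjOn b (Set.Iic l)
  edges_subset : polygonEdges l b ⊆ D.faces
  exists_homeomorph :
    ∃ h : realization D ≃ₜ Metric.closedBall (0 : EuclideanSpace ℝ (Fin 2)) 1,
      ∀ x : realization D, ‖(h x : EuclideanSpace ℝ (Fin 2))‖ = 1 ↔
        ∃ e ∈ polygonEdges l b, supp (x : W → ℝ) ⊆ e

theorem carrier_subset_iff {W : Type*} [DecidableEq W] {σ e : Finset W} {s : Finset (Option W)} :
    carrier σ s ⊆ e ↔ s.eraseNone ⊆ e ∧ (none ∈ s → σ ⊆ e) := by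
  by_cases h : none ∈ s <;> simp [carrier, h, Finset.union_subset_iff]

theorem card_le_two_of_mem_polygonEdges {W : Type*} [DecidableEq W] {l : ℕ} {b : ℕ → W}
    {e : Finset W} (he : e ∈ polygonEdges l b) : e.card ≤ 2 := by
  rcases he with ⟨i, -, rfl⟩ | rfl <;> exact Finset.card_le_two

section

variable {W : Type*} [Fintype W] [DecidableEq W] {D : AbstractSimplicialComplex W} {l : ℕ}
  {b : ℕ → W}

/-- A stellar subdivision of a disc is a disc, once the new boundary polygon is known to be the
subdivision of the old one. -/
theorem IsDisc.stellar_of (h : IsDisc D l b) {σ : Finset W} (hσ : σ ∈ D.faces) (hc : 2 ≤ σ.card)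
    {l' : ℕ} {b' : ℕ → Option W} (hinj : Set.InjOn b' (Set.Iic l'))
    (hsub : polygonEdges l' b' ⊆ (stellar D σ hσ hc).faces)
    (hiff : ∀ s ∈ (stellar D σ hσ hc).faces,
      (∃ e ∈ polygonEdges l' b', s ⊆ e) ↔ ∃ e ∈ polygonEdges l b, carrier σ s ⊆ e) :
    IsDisc (stellar D σ hσ hc) l' b' := by
  obtain ⟨f, hf⟩ := h.exists_homeomorph
  refine ⟨hinj, hsub, (stellarHomeomorph D σ hσ hc).trans f, fun x => ?_⟩
  have hx := mem_realization.1 x.2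
  rw [hiff _ hx.2, Homeomorph.trans_apply, hf]
  change (∃ e ∈ polygonEdges l b, supp (stellarMap σ x) ⊆ e) ↔ _
  rw [supp_stellarMap hx.1.1]

/-- Subdividing a face with more than two vertices leaves the boundary polygon alone. -/
theorem IsDisc.stellar_of_two_lt_card (h : IsDisc D l b) {σ : Finset W} (hσ : σ ∈ D.faces)
    (hc : 2 < σ.card) : IsDisc (stellar D σ hσ hc.le) l (fun i => some (b i)) := by
  have himg : polygonEdges l (fun i => some (b i)) =
      (fun e : Finset W => e.image some) '' polygonEdges l b := by
    ext e
    simp only [polygonEdges, Set.mem_image, Set.mem_ofPred_eq]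
    constructor
    · rintro (⟨i, hi, rfl⟩ | rfl)
      · exact ⟨_, Or.inl ⟨i, hi, rfl⟩, by simp [Finset.image_insert]⟩
      · exact ⟨_, Or.inr rfl, by simp [Finset.image_insert]⟩
    · rintro ⟨e, ⟨i, hi, rfl⟩ | rfl, rfl⟩
      · exact Or.inl ⟨i, hi, by simp [Finset.image_insert]⟩
      · exact Or.inr (by simp [Finset.image_insert])
  have hnot : ∀ e ∈ polygonEdges l b, ¬ σ ⊆ e := fun e he hs => by
    have := Finset.card_le_card hs
    have := card_le_two_of_mem_polygonEdges he
    omega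
  refine h.stellar_of hσ hc.le (fun i hi j hj hij => h.injOn hi hj (Option.some_injective _ hij))
    ?_ fun s hs => ?_
  · rw [himg]
    rintro _ ⟨e, he, rfl⟩
    have heD := h.edges_subset he
    refine ⟨(D.isRelLowerSet_faces heD).1.image _, ?_, ?_⟩
    · rw [Finset.eraseNone_image_some]
      exact hnot e he
    · have : carrier σ (e.image some) = e := by ext; simp [mem_carrier]
      rwa [this]
  · rw [himg, Set.exists_mem_image]
    refine exists_congr fun e => and_congr_right fun he => ?_
    rw [carrier_subset_iff]
    constructor
    · intro h'
      refine ⟨fun w hw => ?_, fun hn => ?_⟩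
      · simpa using h' (Finset.mem_eraseNone.1 hw)
      · simpa using h' hn
    · rintro ⟨h1, h2⟩ (_ | w) hw
      · exact absurd (h2 hw) (hnot e he)
      · simpa using h1 (Finset.mem_eraseNone.2 hw)

/-- The polygon `b 0, …, b l` with one more vertex `none` at its end. -/
def extendPolygon {W : Type*} (l : ℕ) (b : ℕ → W) (i : ℕ) : Option W :=
  if i ≤ l then some (b i) else none

omit [Fintype W] in
theorem mem_polygonEdges_extendPolygon {e : Finset (Option W)} :
    e ∈ polygonEdges (l + 1) (extendPolygon l b) ↔
      (∃ i < l, e = {some (b i), some (b (i + 1))}) ∨ e = {some (b l), none} ∨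
        e = {none, some (b 0)} := by
  simp only [polygonEdges, Set.mem_ofPred_eq, extendPolygon]
  constructor
  · rintro (⟨i, hi, rfl⟩ | rfl)
    · rcases (Nat.lt_succ_iff.1 hi).lt_or_eq with h | rfl
      · exact Or.inl ⟨i, h, by simp [h.le, Nat.succ_le_of_lt h]⟩
      · exact Or.inr (Or.inl (by simp))
    · exact Or.inr (Or.inr (by simp))
  · rintro (⟨i, hi, rfl⟩ | rfl | rfl)
    · exact Or.inl ⟨i, by omega, by simp [hi.le, Nat.succ_le_of_lt hi]⟩
    · exact Or.inl ⟨l, by omega, by simp⟩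
    · exact Or.inr (by simp)

theorem IsDisc.ends_ne (h : IsDisc D l b) (hl : 2 ≤ l) : b l ≠ b 0 := fun h' => by
  have := h.injOn (Set.mem_Iic.2 le_rfl) (Set.mem_Iic.2 (Nat.zero_le l)) h'
  omega

theorem IsDisc.closing_mem (h : IsDisc D l b) : ({b l, b 0} : Finset W) ∈ D.faces :=
  h.edges_subset (Or.inr rfl)

theorem IsDisc.two_le_card (h : IsDisc D l b) (hl : 2 ≤ l) : 2 ≤ ({b l, b 0} : Finset W).card :=
  (Finset.card_pair (h.ends_ne hl)).ge

theorem IsDisc.not_closing_subset (h : IsDisc D l b) (hl : 2 ≤ l) {i : ℕ} (hi : i < l) :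
    ¬ ({b l, b 0} : Finset W) ⊆ {b i, b (i + 1)} := by
  intro hs
  have h1 : b l ∈ ({b i, b (i + 1)} : Finset W) := hs (by simp)
  have h2 : b 0 ∈ ({b i, b (i + 1)} : Finset W) := hs (by simp)
  simp only [Finset.mem_insert, Finset.mem_singleton] at h1 h2
  have inj : ∀ {j k}, j ≤ l → k ≤ l → b j = b k → j = k := fun hj hk e => h.injOn hj hk e
  have h1' := h1.imp (inj le_rfl hi.le) (inj le_rfl (by omega))
  have h2' := h2.imp (inj (by omega) hi.le) (inj (by omega) (by omega))
  omega

theorem IsDisc.stellar_closing (h : IsDisc D l b) (hl : 2 ≤ l) :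
    IsDisc (stellar D {b l, b 0} h.closing_mem (h.two_le_card hl)) (l + 1) (extendPolygon l b) := by
  have hne := h.ends_ne hl
  refine h.stellar_of _ _ ?_ ?_ fun s hs => ?_
  · intro i hi j hj hij
    simp only [Set.mem_Iic] at hi hj
    simp only [extendPolygon] at hij
    split_ifs at hij with h1 h2 h2
    · exact h.injOn h1 h2 (Option.some_injective _ hij)
    · omega
  · intro e he
    rw [mem_polygonEdges_extendPolygon] at he
    rcases he with ⟨i, hi, rfl⟩ | rfl | rfl
    · refine ⟨by simp, ?_, ?_⟩
      · convert h.not_closing_subset hl hi using 2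
        ext; simp
      · have : carrier {b l, b 0} {some (b i), some (b (i + 1))} = {b i, b (i + 1)} := by
          ext; simp [mem_carrier]
        rw [this]
        exact h.edges_subset (Or.inl ⟨i, hi, rfl⟩)
    · refine ⟨by simp, fun hs => ?_, ?_⟩
      · have := hs (Finset.mem_insert_of_mem (Finset.mem_singleton_self (b 0)))
        simp at this
        exact hne this.symm
      · have : carrier {b l, b 0} {some (b l), none} = {b l, b 0} := by
          ext; simp [mem_carrier]
        rw [this]
        exact h.closing_mem
    · refine ⟨by simp, fun hs => ?_, ?_⟩
      · have := hs (Finset.mem_insert_self (b l) _)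
        simp at this
        exact hne this
      · have : carrier {b l, b 0} {none, some (b 0)} = {b l, b 0} := by
          ext; simp only [mem_carrier]; simp; tauto
        rw [this]
        exact h.closing_mem
  · obtain ⟨-, hs2, -⟩ := hs
    constructor
    · rintro ⟨e, he, hse⟩
      have hsub : carrier {b l, b 0} s ⊆ carrier {b l, b 0} e := carrier_mono hse
      rw [mem_polygonEdges_extendPolygon] at he
      rcases he with ⟨i, hi, rfl⟩ | rfl | rfl
      · refine ⟨_, Or.inl ⟨i, hi, rfl⟩, hsub.trans fun w => ?_⟩
        simp [mem_carrier]
      · refine ⟨_, Or.inr rfl, hsub.trans fun w => ?_⟩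
        simp only [mem_carrier]; simp
      · refine ⟨_, Or.inr rfl, hsub.trans fun w => ?_⟩
        simp only [mem_carrier]; simp; tauto
    · rintro ⟨e, he, hse⟩
      rw [carrier_subset_iff] at hse
      rcases he with ⟨i, hi, rfl⟩ | rfl
      · refine ⟨_, mem_polygonEdges_extendPolygon.2 (Or.inl ⟨i, hi, rfl⟩), ?_⟩
        rintro (_ | w) hw
        · exact absurd (hse.2 hw) (h.not_closing_subset hl hi)
        · simpa using hse.1 (Finset.mem_eraseNone.2 hw)
      -- A face over the old closing edge misses one of its two ends.
      · obtain ⟨v, hv, hvs⟩ := Finset.not_subset.1 hs2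
        rw [Finset.mem_eraseNone] at hvs
        have hw : ∀ w, some w ∈ s → w = b l ∨ w = b 0 := fun w hw => by
          simpa using hse.1 (Finset.mem_eraseNone.2 hw)
        simp only [Finset.mem_insert, Finset.mem_singleton] at hv
        rcases hv with rfl | rfl
        · refine ⟨_, mem_polygonEdges_extendPolygon.2 (Or.inr (Or.inr rfl)), ?_⟩
          rintro (_ | w) h'
          · simp
          · rcases hw w h' with rfl | rfl
            · exact absurd h' hvs
            · simp
        · refine ⟨_, mem_polygonEdges_extendPolygon.2 (Or.inr (Or.inl rfl)), ?_⟩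
          rintro (_ | w) h'
          · simp
          · rcases hw w h' with rfl | rfl
            · simp
            · exact absurd h' hvs

end

/-! ### The triangle as a disc -/

theorem lt_of_mem_interior {E : Type*} [NormedAddCommGroup E] [NormedSpace ℝ E] [CompleteSpace E]
    {S : Set E} {f : E →L[ℝ] ℝ} (hf : Function.Surjective f) {a : ℝ} (hS : ∀ p ∈ S, a ≤ f p)
    {p : E} (hp : p ∈ interior S) : a < f p := by
  have h1 : f '' interior S ⊆ Set.Ici a := by
    rintro _ ⟨q, hq, rfl⟩
    exact hS q (interior_subset hq)
  have h2 : IsOpen (f '' interior S) := f.isOpenMap hf _ isOpen_interior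
  have h3 := interior_maximal h1 h2 ⟨p, hp, rfl⟩
  rwa [interior_Ici] at h3

/-- The right triangle onto which the first two barycentric coordinates map the standard
simplex. -/
def planeTriangle : Set (EuclideanSpace ℝ (Fin 2)) := {p | 0 ≤ p 0 ∧ 0 ≤ p 1 ∧ p 0 + p 1 ≤ 1}

theorem interior_planeTriangle :
    interior planeTriangle = {p | 0 < p 0 ∧ 0 < p 1 ∧ p 0 + p 1 < 1} := by
  apply Set.Subset.antisymm
  · intro p hp
    refine ⟨?_, ?_, ?_⟩
    · exact lt_of_mem_interior (f := EuclideanSpace.proj 0)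
        (fun a => ⟨!₂[a, 0], by simp⟩) (fun q hq => hq.1) hp
    · exact lt_of_mem_interior (f := EuclideanSpace.proj 1)
        (fun a => ⟨!₂[0, a], by simp⟩) (fun q hq => hq.2.1) hp
    · have := lt_of_mem_interior (a := -1) (f := -(EuclideanSpace.proj 0 + EuclideanSpace.proj 1))
        (fun a => ⟨!₂[-a, 0], by simp⟩) (fun q hq => by have := hq.2.2; simp; linarith) hp
      simp at this
      linarith
  · refine interior_maximal (fun p hp => ⟨hp.1.le, hp.2.1.le, hp.2.2.le⟩) ?_
    have h : ∀ i, Continuous fun p : EuclideanSpace ℝ (Fin 2) => p i := fun i => by fun_prop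
    exact (isOpen_lt continuous_const (h 0)).inter
      ((isOpen_lt continuous_const (h 1)).inter (isOpen_lt ((h 0).add (h 1)) continuous_const))

theorem isClosed_planeTriangle : IsClosed planeTriangle := by
  have h : ∀ i, Continuous fun p : EuclideanSpace ℝ (Fin 2) => p i := fun i => by fun_prop
  exact (isClosed_le continuous_const (h 0)).inter
    ((isClosed_le continuous_const (h 1)).inter (isClosed_le ((h 0).add (h 1)) continuous_const))

theorem convex_planeTriangle : Convex ℝ planeTriangle := by
  intro p hp q hq s t hs ht hst
  obtain ⟨p0, p1, p2⟩ := hp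
  obtain ⟨q0, q1, q2⟩ := hq
  refine ⟨?_, ?_, ?_⟩
  · simp only [PiLp.add_apply, PiLp.smul_apply, smul_eq_mul]; positivity
  · simp only [PiLp.add_apply, PiLp.smul_apply, smul_eq_mul]; positivity
  · simp only [PiLp.add_apply, PiLp.smul_apply, smul_eq_mul]
    nlinarith [mul_le_mul_of_nonneg_left p2 hs, mul_le_mul_of_nonneg_left q2 ht]

theorem isBounded_planeTriangle : Bornology.IsBounded planeTriangle := by
  refine Metric.isBounded_closedBall (x := 0) (r := 2) |>.subset fun p hp => ?_
  obtain ⟨h0, h1, h2⟩ := hp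
  rw [mem_closedBall_zero_iff, EuclideanSpace.norm_eq, Fin.sum_univ_two]
  refine Real.sqrt_le_iff.2 ⟨by norm_num, ?_⟩
  simp only [Real.norm_eq_abs, sq_abs]
  nlinarith

theorem mem_stdSimplex_three {x : Fin 3 → ℝ} :
    x ∈ stdSimplex ℝ (Fin 3) ↔ 0 ≤ x 0 ∧ 0 ≤ x 1 ∧ 0 ≤ x 2 ∧ x 0 + x 1 + x 2 = 1 := by
  simp only [stdSimplex, Set.mem_ofPred_eq, Fin.forall_fin_succ, Fin.sum_univ_three]
  simp [and_assoc]

/-- The first two barycentric coordinates identify the realisation of the full triangle with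
`planeTriangle`. -/
noncomputable def realizationTriangle :
    realization (⊤ : AbstractSimplicialComplex (Fin 3)) ≃ₜ planeTriangle where
  toFun x := ⟨!₂[(x : Fin 3 → ℝ) 0, (x : Fin 3 → ℝ) 1], by
    obtain ⟨h0, h1, h2, h3⟩ := mem_stdSimplex_three.1 (mem_realization.1 x.2).1
    exact ⟨by simpa using h0, by simpa using h1, by simp; linarith⟩⟩
  invFun p := ⟨![(p : EuclideanSpace ℝ (Fin 2)) 0, (p : EuclideanSpace ℝ (Fin 2)) 1,
      1 - (p : EuclideanSpace ℝ (Fin 2)) 0 - (p : EuclideanSpace ℝ (Fin 2)) 1], by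
    obtain ⟨h0, h1, h2⟩ := p.2
    have hs : ![(p : EuclideanSpace ℝ (Fin 2)) 0, (p : EuclideanSpace ℝ (Fin 2)) 1,
        1 - (p : EuclideanSpace ℝ (Fin 2)) 0 - (p : EuclideanSpace ℝ (Fin 2)) 1] ∈
          stdSimplex ℝ (Fin 3) :=
      mem_stdSimplex_three.2 ⟨h0, h1, by simp; linarith, by simp⟩
    exact mem_realization.2 ⟨hs, supp_nonempty hs⟩⟩
  left_inv x := by
    obtain ⟨h0, h1, h2, h3⟩ := mem_stdSimplex_three.1 (mem_realization.1 x.2).1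
    apply Subtype.ext
    ext i
    fin_cases i
    · simp
    · simp
    · simp; linarith
  right_inv p := by
    apply Subtype.ext
    ext i
    fin_cases i <;> simp
  continuous_toFun := by
    have hx : ∀ w, Continuous fun x : realization (⊤ : AbstractSimplicialComplex (Fin 3)) =>
        (x : Fin 3 → ℝ) w := fun w => (continuous_apply w).comp continuous_subtype_val
    refine Continuous.subtype_mk ((PiLp.continuous_toLp 2 _).comp (continuous_pi fun i => ?_)) _
    fin_cases i
    · exact hx 0
    · exact hx 1
  continuous_invFun := by
    have h : ∀ i, Continuous fun p : planeTriangle => (p : EuclideanSpace ℝ (Fin 2)) i :=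
      fun i => by fun_prop
    refine Continuous.subtype_mk (continuous_pi fun i => ?_) _
    fin_cases i
    · exact h 0
    · exact h 1
    · exact (continuous_const.sub (h 0)).sub (h 1)

theorem exists_polygonEdges_triangle_iff {s : Finset (Fin 3)} :
    (∃ e ∈ polygonEdges 2 (fun i => Fin.ofNat 3 i), s ⊆ e) ↔ ∃ w, w ∉ s := by
  constructor
  · rintro ⟨e, he, hs⟩
    obtain ⟨w, hw⟩ : ∃ w, w ∉ e := by
      by_contra! h
      have h1 : e = Finset.univ := Finset.eq_univ_iff_forall.2 h
      have h2 := card_le_two_of_mem_polygonEdges he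
      simp [h1] at h2
    exact ⟨w, fun h => hw (hs h)⟩
  · rintro ⟨w, hw⟩
    fin_cases w
    · refine ⟨_, Or.inl ⟨1, by norm_num, rfl⟩, fun v hv => ?_⟩
      fin_cases v <;> simp_all
      rfl
    · refine ⟨_, Or.inr rfl, fun v hv => ?_⟩
      fin_cases v <;> simp_all
    · refine ⟨_, Or.inl ⟨0, by norm_num, rfl⟩, fun v hv => ?_⟩
      fin_cases v <;> simp_all
      rfl

theorem isDisc_triangle :
    IsDisc (⊤ : AbstractSimplicialComplex (Fin 3)) 2 (fun i => Fin.ofNat 3 i) := by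
  refine ⟨?_, ?_, ?_⟩
  · intro i hi j hj hij
    simp only [Set.mem_Iic] at hi hj
    have := congrArg Fin.val hij
    simp only [Fin.ofNat] at this
    omega
  · rintro e (⟨i, -, rfl⟩ | rfl) <;> exact Finset.insert_nonempty _ _
  · obtain ⟨g, -, hcl, hfr⟩ := exists_homeomorph_image_interior_closure_frontier_eq_unitBall
      convex_planeTriangle (by
        rw [interior_planeTriangle]
        exact ⟨!₂[1 / 4, 1 / 4], by norm_num⟩) isBounded_planeTriangle
    rw [isClosed_planeTriangle.closure_eq] at hcl
    refine ⟨realizationTriangle.trans ((g.image _).trans (Homeomorph.setCongr hcl)), fun x => ?_⟩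
    rw [exists_polygonEdges_triangle_iff]
    obtain ⟨h0, h1, h2, h3⟩ := mem_stdSimplex_three.1 (mem_realization.1 x.2).1
    change ‖g (realizationTriangle x)‖ = 1 ↔ _
    rw [← mem_sphere_zero_iff_norm, ← hfr, g.injective.mem_set_image,
      isClosed_planeTriangle.frontier_eq, interior_planeTriangle]
    simp only [mem_supp, not_not, Fin.exists_fin_succ]
    change (realizationTriangle x : EuclideanSpace ℝ (Fin 2)) ∈ planeTriangle ∧
      ¬ (0 < (x : Fin 3 → ℝ) 0 ∧ 0 < (x : Fin 3 → ℝ) 1 ∧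
        (x : Fin 3 → ℝ) 0 + (x : Fin 3 → ℝ) 1 < 1) ↔ _
    simp only [Subtype.coe_prop, true_and]
    constructor
    · intro h
      by_contra! h'
      obtain ⟨a, b, c, -⟩ := h'
      refine h ⟨lt_of_le_of_ne h0 (Ne.symm a), lt_of_le_of_ne h1 (Ne.symm b), ?_⟩
      have : 0 < (x : Fin 3 → ℝ) 2 := lt_of_le_of_ne h2 (Ne.symm c)
      linarith
    · rintro h ⟨a, b, c⟩
      rcases h with h | h | h | ⟨w, -⟩
      · exact a.ne' h
      · exact b.ne' h
      · have h : (x : Fin 3 → ℝ) 2 = 0 := h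
        linarith
      · exact w.elim0

/-! ### Counting triangles -/

section Count

variable {W : Type*} [DecidableEq W] {D : AbstractSimplicialComplex W} {σ : Finset W}
  {hσ : σ ∈ D.faces} {hc : 2 ≤ σ.card}

theorem eraseNone_subset_carrier (s : Finset (Option W)) : s.eraseNone ⊆ carrier σ s :=
  Finset.subset_union_left

theorem card_le_three_stellar (hD : ∀ s ∈ D.faces, s.card ≤ 3) :
    ∀ s ∈ (stellar D σ hσ hc).faces, s.card ≤ 3 := by
  rintro s ⟨-, hs, hs'⟩
  have h3 := hD _ hs'
  by_cases hn : none ∈ s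
  · have hlt : s.eraseNone.card < (carrier σ s).card := by
      refine Finset.card_lt_card (Finset.ssubset_iff_subset_ne.2
        ⟨eraseNone_subset_carrier s, fun he => hs ?_⟩)
      rw [he, carrier, if_pos hn]
      exact Finset.subset_union_right
    have := Finset.card_eraseNone_of_mem hn
    omega
  · rw [carrier, if_neg hn, Finset.union_empty, Finset.card_eraseNone_of_not_mem hn] at h3
    exact h3

/-- If `σ` lies in only one triangle `T` then subdividing at `σ` replaces `T` by one triangle for
each vertex of `σ`. -/
theorem ncard_triangles_stellar [Finite W] {T : Finset W} (hT : T ∈ triangles D) (hσT : σ ⊆ T)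
    (hmax : ∀ s ∈ D.faces, σ ⊆ s → s ⊆ T) :
    (triangles (stellar D σ hσ hc)).ncard + 1 ≤ (triangles D).ncard + σ.card := by
  have hsub : triangles (stellar D σ hσ hc) ⊆
      (fun s : Finset W => s.image some) '' (triangles D \ {T}) ∪
        (fun x => insert none ((T.erase x).image some)) '' (σ : Set W) := by
    rintro s ⟨⟨-, hs, hs'⟩, h3⟩
    by_cases hn : none ∈ s
    · right
      have hcT : carrier σ s ⊆ T := by
        refine hmax _ hs' ?_
        rw [carrier, if_pos hn]
        exact Finset.subset_union_right
      obtain ⟨x, hx, hxs⟩ := Finset.not_subset.1 hs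
      refine ⟨x, hx, ?_⟩
      have he : s.eraseNone = T.erase x := by
        refine Finset.eq_of_subset_of_card_le (fun w hw => Finset.mem_erase.2
          ⟨fun h => hxs (h ▸ hw), hcT (eraseNone_subset_carrier s hw)⟩) ?_
        rw [Finset.card_erase_of_mem (hσT hx), hT.2, Finset.card_eraseNone_of_mem hn, h3]
      dsimp only
      rw [← he, Finset.image_some_eraseNone, Finset.insert_erase hn]
    · left
      have hcs : carrier σ s = s.eraseNone := by rw [carrier, if_neg hn, Finset.union_empty]
      rw [hcs] at hs'
      refine ⟨s.eraseNone, ⟨⟨hs', ?_⟩, fun h => hs ?_⟩, ?_⟩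
      · rw [Finset.card_eraseNone_of_not_mem hn, h3]
      · rw [Set.mem_singleton_iff.1 h]
        exact hσT
      · dsimp only
        rw [Finset.image_some_eraseNone, Finset.erase_eq_of_notMem hn]
  have h1 := Set.ncard_le_ncard hsub (Set.toFinite _)
  have h2 := Set.ncard_union_le ((fun s : Finset W => s.image some) '' (triangles D \ {T}))
    ((fun x => insert none ((T.erase x).image some)) '' (σ : Set W))
  have h3 : _ ≤ (triangles D \ {T}).ncard :=
    Set.ncard_image_le (f := fun s : Finset W => s.image some) (Set.toFinite _)
  have h4 : _ ≤ (σ : Set W).ncard :=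
    Set.ncard_image_le (f := fun x => insert none ((T.erase x).image some)) (Set.toFinite _)
  rw [Set.ncard_coe_finset] at h4
  have h5 := Set.ncard_sdiff_singleton_add_one hT (Set.toFinite _)
  omega

end Count

/-! ### Discs that are simplicial away from the closing edge -/

/-- A triangulated disc `D` with a vertex map to `Y` that is simplicial on the faces not containing
the closing edge `{b l, b 0}` of the boundary polygon; that edge lies in a single triangle, with
apex `c`. -/
structure FanDisc {V W : Type*} [DecidableEq V] [Fintype W] [DecidableEq W]
    (Y : AbstractSimplicialComplex V) (D : AbstractSimplicialComplex W) (l : ℕ) (b : ℕ → W) (c : W)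
    (β : W → V) : Prop where
  isDisc : IsDisc D l b
  two_le : 2 ≤ l
  card_le_three : ∀ s ∈ D.faces, s.card ≤ 3
  apex_mem : {c, b l, b 0} ∈ D.faces
  apex_ne_last : c ≠ b l
  apex_ne_zero : c ≠ b 0
  subset_apex : ∀ s ∈ D.faces, {b l, b 0} ⊆ s → s ⊆ {c, b l, b 0}
  image_mem : ∀ s ∈ D.faces, ¬ {b l, b 0} ⊆ s → s.image β ∈ Y.faces

section Fan

variable {V W : Type*} [DecidableEq V] [Fintype W] [DecidableEq W]
  {Y : AbstractSimplicialComplex V} {D : AbstractSimplicialComplex W} {l : ℕ} {b : ℕ → W} {c : W}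
  {β : W → V}

omit [Fintype W] [DecidableEq W] in
theorem image_mem_of_forall {s : Finset W} (hs : s.Nonempty) {f : W → V} {t : Finset V}
    (ht : t ∈ Y.faces) (h : ∀ w ∈ s, f w ∈ t) : s.image f ∈ Y.faces :=
  (Y.isRelLowerSet_faces ht).2 (Finset.image_subset_iff.2 h) (hs.image f)

omit [Fintype W] [DecidableEq W] in
theorem image_elim_eq {s : Finset (Option W)} (hn : none ∉ s) (v : V) :
    s.image (fun o => o.elim v β) = s.eraseNone.image β := by
  ext x
  simp only [Finset.mem_image, Finset.mem_eraseNone]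
  constructor
  · rintro ⟨_ | w, hw, rfl⟩
    · exact absurd hw hn
    · exact ⟨w, hw, rfl⟩
  · rintro ⟨w, hw, rfl⟩
    exact ⟨some w, hw, rfl⟩

theorem FanDisc.apex_mem_triangles (h : FanDisc Y D l b c β) :
    ({c, b l, b 0} : Finset W) ∈ triangles D := by
  refine ⟨h.apex_mem, Finset.card_eq_three.2 ⟨c, b l, b 0, h.apex_ne_last, h.apex_ne_zero,
    h.isDisc.ends_ne h.two_le, rfl⟩⟩

omit [Fintype W] in
/-- A face that contains the new vertex and lies over the triangle at the closing edge is mapped to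
a face, if the two triangles formed by the new vertex, the apex and one end of the edge are. -/
theorem image_mem_of_none_mem {s : Finset (Option W)} {v : V} (hn : none ∈ s)
    (hs : s.eraseNone ⊆ {c, b l, b 0})
    (h1 : some (b 0) ∉ s → {β c, β (b l), v} ∈ Y.faces)
    (h2 : some (b 0) ∈ s → {β c, v, β (b 0)} ∈ Y.faces)
    (h12 : ¬ (some (b l) ∈ s ∧ some (b 0) ∈ s)) :
    s.image (fun o => o.elim v β) ∈ Y.faces := by
  have hs' : ∀ w, some w ∈ s → w = c ∨ w = b l ∨ w = b 0 := fun w hw => by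
    simpa using hs (Finset.mem_eraseNone.2 hw)
  by_cases h0 : some (b 0) ∈ s
  · have hl : some (b l) ∉ s := fun hl => h12 ⟨hl, h0⟩
    refine image_mem_of_forall ⟨_, hn⟩ (h2 h0) ?_
    rintro (_ | w) hw
    · simp
    · rcases hs' w hw with rfl | rfl | rfl
      · simp
      · exact absurd hw hl
      · simp
  · refine image_mem_of_forall ⟨_, hn⟩ (h1 h0) ?_
    rintro (_ | w) hw
    · simp
    · rcases hs' w hw with rfl | rfl | rfl
      · simp
      · simp
      · exact absurd hw h0

theorem FanDisc.carrier_closing_subset (h : FanDisc Y D l b c β) {s : Finset (Option W)}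
    (hs : carrier {b l, b 0} s ∈ D.faces) (hn : none ∈ s) : s.eraseNone ⊆ {c, b l, b 0} := by
  refine (eraseNone_subset_carrier s).trans (h.subset_apex _ hs ?_)
  rw [carrier, if_pos hn]
  exact Finset.subset_union_right

/-- Splitting the closing edge at a new vertex keeps the apex, and one of the two halves becomes
the new closing edge. -/
theorem FanDisc.split (h : FanDisc Y D l b c β) {v : V} (hv : {β c, β (b l), v} ∈ Y.faces) :
    FanDisc Y (stellar D {b l, b 0} h.isDisc.closing_mem (h.isDisc.two_le_card h.two_le)) (l + 1)
      (extendPolygon l b) (some c) (fun o => o.elim v β) := by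
  have e1 : extendPolygon l b (l + 1) = none := by simp [extendPolygon]
  have e2 : extendPolygon l b 0 = some (b 0) := by simp [extendPolygon]
  have hne := h.isDisc.ends_ne h.two_le
  refine ⟨h.isDisc.stellar_closing h.two_le, by have := h.two_le; omega,
    card_le_three_stellar h.card_le_three, ?_, ?_, ?_, ?_, ?_⟩
  all_goals simp only [e1, e2]
  · refine ⟨by simp, fun hs => ?_, ?_⟩
    · have := hs (Finset.mem_insert_self (b l) _)
      simp only [Finset.mem_eraseNone, Finset.mem_insert, Finset.mem_singleton,
        Option.some.injEq, reduceCtorEq, false_or] at this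
      exact this.elim (fun e => h.apex_ne_last e.symm) hne
    · have : carrier {b l, b 0} {some c, none, some (b 0)} = {c, b l, b 0} := by
        ext; simp only [mem_carrier]; simp; tauto
      rw [this]
      exact h.apex_mem
  · simp
  · simpa using h.apex_ne_zero
  · rintro s ⟨-, hs1, hs2⟩ hs
    have hn : none ∈ s := hs (by simp)
    have h0 : some (b 0) ∈ s := hs (by simp)
    have hsub := h.carrier_closing_subset hs2 hn
    rintro (_ | w) hw
    · simp
    · have := hsub (Finset.mem_eraseNone.2 hw)
      simp only [Finset.mem_insert, Finset.mem_singleton] at this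
      rcases this with rfl | rfl | rfl
      · simp
      · refine absurd (fun x hx => ?_) hs1
        simp only [Finset.mem_insert, Finset.mem_singleton] at hx
        rcases hx with rfl | rfl
        · exact Finset.mem_eraseNone.2 hw
        · exact Finset.mem_eraseNone.2 h0
      · simp
  · rintro s ⟨-, hs1, hs2⟩ hs
    by_cases hn : none ∈ s
    · have h0 : some (b 0) ∉ s := fun h0 => hs (by simp [Finset.insert_subset_iff, hn, h0])
      refine image_mem_of_none_mem hn (h.carrier_closing_subset hs2 hn) (fun _ => hv)
        (fun h' => absurd h' h0) fun h' => h0 h'.2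
    · rw [image_elim_eq hn]
      rw [carrier, if_neg hn, Finset.union_empty] at hs2
      exact h.image_mem _ hs2 hs1

/-- Splitting the closing edge completes a `FanDisc` to a simplicial disc. -/
theorem FanDisc.isSimplicialMap_split (h : FanDisc Y D l b c β) {v : V}
    (hv : {β c, β (b l), v} ∈ Y.faces) (hv' : {β c, v, β (b 0)} ∈ Y.faces) :
    IsSimplicialMap
      (stellar D {b l, b 0} h.isDisc.closing_mem (h.isDisc.two_le_card h.two_le)) Y
      (fun o => o.elim v β) := by
  rintro s ⟨-, hs1, hs2⟩
  by_cases hn : none ∈ s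
  · refine image_mem_of_none_mem hn (h.carrier_closing_subset hs2 hn) (fun _ => hv)
      (fun _ => hv') fun h' => hs1 ?_
    simpa [Finset.insert_subset_iff] using h'
  · rw [image_elim_eq hn]
    rw [carrier, if_neg hn, Finset.union_empty] at hs2
    exact h.image_mem _ hs2 hs1

/-- Subdividing the triangle at the closing edge makes the new vertex the apex. -/
theorem FanDisc.cone (h : FanDisc Y D l b c β) {v : V} (hv : {β c, β (b l), v} ∈ Y.faces)
    (hv' : {β c, v, β (b 0)} ∈ Y.faces) :
    FanDisc Y (stellar D {c, b l, b 0} h.apex_mem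
        (Nat.le_of_lt (by rw [h.apex_mem_triangles.2]; norm_num))) l
      (fun i => some (b i)) none (fun o => o.elim v β) := by
  have hT : ({c, b l, b 0} : Finset W).card = 3 := h.apex_mem_triangles.2
  -- A face containing the new vertex or the closing edge lies over the subdivided triangle.
  have key : ∀ s : Finset (Option W), carrier {c, b l, b 0} s ∈ D.faces →
      (none ∈ s ∨ {some (b l), some (b 0)} ⊆ s) → s.eraseNone ⊆ {c, b l, b 0} := by
    intro s hs h'
    refine (eraseNone_subset_carrier s).trans (h.subset_apex _ hs fun w hw => ?_)
    rw [mem_carrier]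
    rcases h' with hn | h'
    · exact Or.inr ⟨hn, Finset.mem_insert_of_mem hw⟩
    · refine Or.inl (h' ?_)
      simpa using hw
  refine ⟨h.isDisc.stellar_of_two_lt_card h.apex_mem (by omega), h.two_le,
    card_le_three_stellar h.card_le_three, ?_, by simp, by simp, ?_, ?_⟩
  · refine ⟨by simp, fun hs => ?_, ?_⟩
    · have := hs (Finset.mem_insert_self c _)
      simp only [Finset.mem_eraseNone, Finset.mem_insert, Finset.mem_singleton,
        Option.some.injEq, reduceCtorEq, false_or] at this
      exact this.elim h.apex_ne_last h.apex_ne_zero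
    · have : carrier {c, b l, b 0} {none, some (b l), some (b 0)} = {c, b l, b 0} := by
        ext; simp only [mem_carrier]; simp; tauto
      rw [this]
      exact h.apex_mem
  · rintro s ⟨-, hs1, hs2⟩ hs
    have hsub := key s hs2 (Or.inr hs)
    rintro (_ | w) hw
    · simp
    · have := hsub (Finset.mem_eraseNone.2 hw)
      simp only [Finset.mem_insert, Finset.mem_singleton] at this
      rcases this with rfl | rfl | rfl
      · refine absurd (fun x hx => Finset.mem_eraseNone.2 ?_) hs1
        simp only [Finset.mem_insert, Finset.mem_singleton] at hx
        rcases hx with rfl | rfl | rfl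
        · exact hw
        · exact hs (by simp)
        · exact hs (by simp)
      · simp
      · simp
  · rintro s ⟨-, hs1, hs2⟩ hs
    by_cases hn : none ∈ s
    · refine image_mem_of_none_mem hn (key s hs2 (Or.inl hn)) (fun _ => hv)
        (fun _ => hv') fun h' => hs ?_
      simpa [Finset.insert_subset_iff] using h'
    · rw [image_elim_eq hn]
      rw [carrier, if_neg hn, Finset.union_empty] at hs2
      refine h.image_mem _ hs2 fun h' => hs fun x hx => ?_
      simp only [Finset.mem_insert, Finset.mem_singleton] at hx
      rcases hx with rfl | rfl
      · exact Finset.mem_eraseNone.1 (h' (by simp))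
      · exact Finset.mem_eraseNone.1 (h' (by simp))

end Fan

/-! ### The cone over a triangle -/

/-- The cone over the boundary of a triangle. -/
def triangleCone : AbstractSimplicialComplex (Option (Fin 3)) :=
  stellar ⊤ Finset.univ Finset.univ_nonempty (by simp)

theorem isDisc_triangleCone : IsDisc triangleCone 2 (fun i => some (Fin.ofNat 3 i)) :=
  isDisc_triangle.stellar_of_two_lt_card _ (by simp)

theorem exists_some_notMem_of_mem_triangleCone {s : Finset (Option (Fin 3))}
    (hs : s ∈ triangleCone.faces) : some 0 ∉ s ∨ some 1 ∉ s ∨ some 2 ∉ s := by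
  by_contra! h
  refine hs.2.1 fun i _ => Finset.mem_eraseNone.2 ?_
  fin_cases i
  exacts [h.1, h.2.1, h.2.2]

theorem card_le_three_triangleCone : ∀ s ∈ triangleCone.faces, s.card ≤ 3 :=
  card_le_three_stellar fun s _ => by simpa using s.card_le_univ

theorem ncard_triangles_triangleCone : (triangles triangleCone).ncard ≤ 3 := by
  have hT : (Finset.univ : Finset (Fin 3)) ∈
      triangles (⊤ : AbstractSimplicialComplex (Fin 3)) := ⟨Finset.univ_nonempty, by simp⟩
  have h1 : (triangles (⊤ : AbstractSimplicialComplex (Fin 3))).ncard ≤ 1 := by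
    refine (Set.ncard_le_one (Set.toFinite _)).2 fun s hs t ht => ?_
    rw [(Finset.card_eq_iff_eq_univ s).1 hs.2, (Finset.card_eq_iff_eq_univ t).1 ht.2]
  have h2 := ncard_triangles_stellar (hσ := Finset.univ_nonempty) (hc := by simp) hT
    (Finset.Subset.refl _) fun s _ _ => Finset.subset_univ s
  have h3 : (triangles triangleCone).ncard + 1 ≤ _ := h2
  simp only [Finset.card_univ, Fintype.card_fin] at h3
  omega

/-- The vertex map of the cone over a triangle. -/
def triangleConeMap {V : Type*} (a : ℕ → V) (v : V) (o : Option (Fin 3)) : V :=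
  o.elim v fun i => a i

theorem image_triangleConeMap_mem {V : Type*} [DecidableEq V] {Y : AbstractSimplicialComplex V}
    {a : ℕ → V} {v : V} {s : Finset (Option (Fin 3))} (hs : s ∈ triangleCone.faces) {i j : Fin 3}
    (hij : ∀ k, some k ∈ s → k = i ∨ k = j) (h : {v, a i, a j} ∈ Y.faces) :
    s.image (triangleConeMap a v) ∈ Y.faces := by
  refine image_mem_of_forall hs.1 h ?_
  rintro (_ | k) hk
  · simp [triangleConeMap]
  · rcases hij k hk with rfl | rfl <;> simp [triangleConeMap]

theorem fanDisc_triangleCone {V : Type*} [DecidableEq V] {Y : AbstractSimplicialComplex V}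
    {a : ℕ → V} {v : V} (h0 : {v, a 0, a 1} ∈ Y.faces) (h1 : {v, a 1, a 2} ∈ Y.faces) :
    FanDisc Y triangleCone 2 (fun i => some (Fin.ofNat 3 i)) none (triangleConeMap a v) := by
  refine ⟨isDisc_triangleCone, le_rfl, card_le_three_triangleCone, ?_, by simp, by simp, ?_, ?_⟩
  · refine ⟨by simp, fun h => ?_,
      carrier_nonempty Finset.univ_nonempty (Finset.insert_nonempty _ _)⟩
    have := h (Finset.mem_univ 1)
    simp at this
  · intro s hs h
    have h0 : some (0 : Fin 3) ∈ s := h (by simp)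
    have h2 : some (2 : Fin 3) ∈ s := h (by simp)
    have h1 : some (1 : Fin 3) ∉ s := by
      rcases exists_some_notMem_of_mem_triangleCone hs with h | h | h
      exacts [absurd h0 h, h, absurd h2 h]
    rintro (_ | k) hk
    · simp
    · fin_cases k
      · simp
      · exact absurd hk h1
      · simp
  · intro s hs h
    have h : some (0 : Fin 3) ∉ s ∨ some (2 : Fin 3) ∉ s := by
      by_contra! h'
      refine h fun x hx => ?_
      simp only [Finset.mem_insert, Finset.mem_singleton] at hx
      rcases hx with rfl | rfl
      exacts [h'.2, h'.1]
    rcases h with h | h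
    · refine image_triangleConeMap_mem (i := 1) (j := 2) hs (fun k hk => ?_) h1
      fin_cases k
      exacts [absurd hk h, Or.inl rfl, Or.inr rfl]
    · refine image_triangleConeMap_mem (i := 0) (j := 1) hs (fun k hk => ?_) h0
      fin_cases k
      exacts [Or.inl rfl, Or.inr rfl, absurd hk h]

theorem isSimplicialMap_triangleCone {V : Type*} [DecidableEq V]
    {Y : AbstractSimplicialComplex V} {a : ℕ → V} {v : V} (h0 : {v, a 0, a 1} ∈ Y.faces)
    (h1 : {v, a 1, a 2} ∈ Y.faces) (h2 : {v, a 2, a 0} ∈ Y.faces) :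
    IsSimplicialMap triangleCone Y (triangleConeMap a v) := by
  intro s hs
  rcases exists_some_notMem_of_mem_triangleCone hs with h | h | h
  · refine image_triangleConeMap_mem (i := 1) (j := 2) hs (fun k hk => ?_) h1
    fin_cases k
    exacts [absurd hk h, Or.inl rfl, Or.inr rfl]
  · refine image_triangleConeMap_mem (i := 2) (j := 0) hs (fun k hk => ?_) h2
    fin_cases k
    exacts [Or.inr rfl, absurd hk h, Or.inl rfl]
  · refine image_triangleConeMap_mem (i := 0) (j := 1) hs (fun k hk => ?_) h0
    fin_cases k
    exacts [Or.inl rfl, Or.inr rfl, absurd hk h]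

/-! ### Counting vertices and triangles of fillings -/

section Filling

variable {V : Type*} [DecidableEq V] {Y : AbstractSimplicialComplex V} {a : ℕ → V} {l k t : ℕ}
  {u v : V}

/-- The path `a 0, …, a l` in `Y` is the boundary, without its closing edge, of a `FanDisc` whose
apex is mapped to `u`, with at most `k` internal vertices and at most `t` triangles. -/
def HasFan (Y : AbstractSimplicialComplex V) (a : ℕ → V) (l : ℕ) (u : V) (k t : ℕ) : Prop :=
  ∃ (W : Type) (_ : Fintype W) (_ : DecidableEq W) (D : AbstractSimplicialComplex W)
    (b : ℕ → W) (c : W) (β : W → V), FanDisc Y D l b c β ∧ (∀ i ≤ l, β (b i) = a i) ∧ β c = u ∧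
      Fintype.card W ≤ l + 1 + k ∧ (triangles D).ncard ≤ t

/-- The loop `a 0, …, a l` in `Y` bounds a simplicial disc with at most `k` internal vertices and
at most `t` triangles. -/
def HasDisc (Y : AbstractSimplicialComplex V) (a : ℕ → V) (l k t : ℕ) : Prop :=
  ∃ (W : Type) (_ : Fintype W) (_ : DecidableEq W) (D : AbstractSimplicialComplex W)
    (b : ℕ → W) (β : W → V), IsDisc D l b ∧ IsSimplicialMap D Y β ∧ (∀ i ≤ l, β (b i) = a i) ∧
      Fintype.card W ≤ l + 1 + k ∧ (triangles D).ncard ≤ t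

theorem HasFan.mono (h : HasFan Y a l u k t) {k' t' : ℕ} (hk : k ≤ k') (ht : t ≤ t') :
    HasFan Y a l u k' t' := by
  obtain ⟨W, i1, i2, D, b, c, β, h1, h2, h3, h4, h5⟩ := h
  exact ⟨W, i1, i2, D, b, c, β, h1, h2, h3, by omega, by omega⟩

theorem HasFan.congr (h : HasFan Y a l u k t) {a' : ℕ → V} (ha : ∀ i ≤ l, a i = a' i) :
    HasFan Y a' l u k t := by
  obtain ⟨W, i1, i2, D, b, c, β, h1, h2, h⟩ := h
  exact ⟨W, i1, i2, D, b, c, β, h1, fun i hi => (h2 i hi).trans (ha i hi), h⟩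

theorem HasDisc.mono (h : HasDisc Y a l k t) {k' t' : ℕ} (hk : k ≤ k') (ht : t ≤ t') :
    HasDisc Y a l k' t' := by
  obtain ⟨W, i1, i2, D, b, β, h1, h2, h3, h4, h5⟩ := h
  exact ⟨W, i1, i2, D, b, β, h1, h2, h3, by omega, by omega⟩

theorem FanDisc.ncard_triangles_split {W : Type*} [Fintype W] [DecidableEq W]
    {D : AbstractSimplicialComplex W} {b : ℕ → W} {c : W} {β : W → V} (h : FanDisc Y D l b c β) :
    (triangles (stellar D {b l, b 0} h.isDisc.closing_mem
      (h.isDisc.two_le_card h.two_le))).ncard ≤ (triangles D).ncard + 1 := by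
  have h1 := ncard_triangles_stellar (hσ := h.isDisc.closing_mem)
    (hc := h.isDisc.two_le_card h.two_le) h.apex_mem_triangles (Finset.subset_insert _ _)
    h.subset_apex
  have h2 := Finset.card_pair (h.isDisc.ends_ne h.two_le)
  omega

omit [DecidableEq V] in
theorem elim_extendPolygon {W : Type*} {b : ℕ → W} {β : W → V} (ha : ∀ i ≤ l, β (b i) = a i)
    (i : ℕ) (hi : i ≤ l + 1) : (extendPolygon l b i).elim (a (l + 1)) β = a i := by
  unfold extendPolygon
  split_ifs with h
  · exact ha i h
  · rw [show i = l + 1 by omega]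
    rfl

theorem HasFan.split (h : HasFan Y a l u k t) (hv : {u, a l, a (l + 1)} ∈ Y.faces) :
    HasFan Y a (l + 1) u k (t + 1) := by
  obtain ⟨W, i1, i2, D, b, c, β, h1, h2, rfl, h4, h5⟩ := h
  rw [← h2 l le_rfl] at hv
  refine ⟨Option W, _, inferInstance, _, _, _, _, h1.split hv, elim_extendPolygon h2, rfl, ?_, ?_⟩
  · rw [Fintype.card_option]
    omega
  · have := h1.ncard_triangles_split
    omega

theorem HasFan.close (h : HasFan Y a l u k t) (hv : {u, a l, a (l + 1)} ∈ Y.faces)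
    (hv' : {u, a (l + 1), a 0} ∈ Y.faces) : HasDisc Y a (l + 1) k (t + 1) := by
  obtain ⟨W, i1, i2, D, b, c, β, h1, h2, rfl, h4, h5⟩ := h
  rw [← h2 l le_rfl] at hv
  rw [← h2 0 (Nat.zero_le l)] at hv'
  refine ⟨Option W, _, inferInstance, _, _, _, h1.isDisc.stellar_closing h1.two_le,
    h1.isSimplicialMap_split hv hv', elim_extendPolygon h2, ?_, ?_⟩
  · rw [Fintype.card_option]
    omega
  · have := h1.ncard_triangles_split
    omega

theorem HasFan.cone (h : HasFan Y a l u k t) (hv : {u, a l, v} ∈ Y.faces)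
    (hv' : {u, v, a 0} ∈ Y.faces) : HasFan Y a l v (k + 1) (t + 2) := by
  obtain ⟨W, i1, i2, D, b, c, β, h1, h2, rfl, h4, h5⟩ := h
  rw [← h2 l le_rfl] at hv
  rw [← h2 0 (Nat.zero_le l)] at hv'
  refine ⟨Option W, _, inferInstance, _, _, _, _, h1.cone hv hv', h2, rfl, ?_, ?_⟩
  · rw [Fintype.card_option]
    omega
  · have hT := h1.apex_mem_triangles
    have := ncard_triangles_stellar (hσ := h1.apex_mem) (hc := by rw [hT.2]; norm_num) hT
      (Finset.Subset.refl _)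
      fun s hs hs' => h1.subset_apex s hs ((Finset.subset_insert _ _).trans hs')
    have := hT.2
    omega

theorem HasFan.extend (h : HasFan Y a l u k t) (m : ℕ)
    (hm : ∀ i, l ≤ i → i < l + m → {u, a i, a (i + 1)} ∈ Y.faces) :
    HasFan Y a (l + m) u k (t + m) := by
  induction m with
  | zero => exact h
  | succ m ih =>
    exact (ih fun i h1 h2 => hm i h1 (by omega)).split (hm (l + m) (by omega) (by omega))

omit [DecidableEq V] in
theorem triangleConeMap_ofNat (i : ℕ) (hi : i ≤ 2) :
    triangleConeMap a v (some (Fin.ofNat 3 i)) = a i := by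
  change a (i % 3) = a i
  rw [Nat.mod_eq_of_lt (by omega)]

theorem hasFan_two (h0 : {v, a 0, a 1} ∈ Y.faces) (h1 : {v, a 1, a 2} ∈ Y.faces) :
    HasFan Y a 2 v 1 3 :=
  ⟨_, _, inferInstance, _, _, _, _, fanDisc_triangleCone h0 h1, triangleConeMap_ofNat, rfl,
    by simp, ncard_triangles_triangleCone⟩

theorem hasDisc_two (h0 : {v, a 0, a 1} ∈ Y.faces) (h1 : {v, a 1, a 2} ∈ Y.faces)
    (h2 : {v, a 2, a 0} ∈ Y.faces) : HasDisc Y a 2 1 3 :=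
  ⟨_, _, inferInstance, _, _, _, isDisc_triangleCone, isSimplicialMap_triangleCone h0 h1 h2,
    triangleConeMap_ofNat, by simp, ncard_triangles_triangleCone⟩

end Filling

/-! ### Filling loops in ample complexes -/

section Ample

variable {V : Type*} [DecidableEq V] {Y : AbstractSimplicialComplex V} {r : ℕ}

/-- In an ample complex every small induced subcomplex lies in the link of a vertex. -/
theorem IsAmple.exists_cone (hY : IsAmple r Y) {U : Finset V} (hU : U.card ≤ r) :
    ∃ v, ∀ s ∈ Y.faces, s ⊆ U → insert v s ∈ Y.faces := by
  obtain ⟨v, -, hv⟩ := hY.2.2 U hU _ le_rfl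
  refine ⟨v, fun s hs hsU => ?_⟩
  have h : s ∈ (link Y v ⊓ induced Y U).faces := by
    rw [hv]
    exact ⟨hs, hsU⟩
  exact h.1.2.2

/-- `a 0, …, a l` is a closed edge path in `Y`. -/
def IsEdgeLoop (Y : AbstractSimplicialComplex V) (a : ℕ → V) (l : ℕ) : Prop :=
  (∀ i < l, {a i, a (i + 1)} ∈ Y.faces) ∧ {a l, a 0} ∈ Y.faces

theorem exists_cone_loop (hY : IsAmple r Y) {a : ℕ → V} {l : ℕ} (ha : IsEdgeLoop Y a l)
    (hl : l + 1 ≤ r) :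
    ∃ v, (∀ i < l, {v, a i, a (i + 1)} ∈ Y.faces) ∧ {v, a l, a 0} ∈ Y.faces := by
  obtain ⟨v, hv⟩ := hY.exists_cone (U := (Finset.range (l + 1)).image a)
    (Finset.card_image_le.trans (by rwa [Finset.card_range]))
  have hm : ∀ i ≤ l, a i ∈ (Finset.range (l + 1)).image a := fun i hi =>
    Finset.mem_image_of_mem a (Finset.mem_range.2 (by omega))
  refine ⟨v, fun i hi => hv _ (ha.1 i hi) ?_, hv _ ha.2 ?_⟩
  · simp only [Finset.insert_subset_iff, Finset.singleton_subset_iff]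
    exact ⟨hm i hi.le, hm _ hi⟩
  · simp only [Finset.insert_subset_iff, Finset.singleton_subset_iff]
    exact ⟨hm l le_rfl, hm 0 (Nat.zero_le l)⟩

/-- A loop with `l + 2` vertices is filled up to the last edge subdivision, with one cone point
for every `r - 3` vertices: a cone over `r` consecutive vertices, ending at `a 0`, shortens the
loop by `r - 3`. -/
theorem exists_hasFan (hr : 4 ≤ r) (hY : IsAmple r Y) (k : ℕ) :
    ∀ (a : ℕ → V) (l : ℕ), 2 ≤ l → IsEdgeLoop Y a (l + 1) → l + 2 ≤ 3 + (k + 1) * (r - 3) →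
      ∃ u, HasFan Y a l u (k + 1) ((k + 1) * (r - 1)) ∧ {u, a l, a (l + 1)} ∈ Y.faces ∧
        {u, a (l + 1), a 0} ∈ Y.faces := by
  have short : ∀ (k : ℕ) (a : ℕ → V) (l : ℕ), 2 ≤ l → IsEdgeLoop Y a (l + 1) → l + 2 ≤ r →
      ∃ u, HasFan Y a l u (k + 1) ((k + 1) * (r - 1)) ∧ {u, a l, a (l + 1)} ∈ Y.faces ∧
        {u, a (l + 1), a 0} ∈ Y.faces := by
    intro k a l hl ha hlr
    obtain ⟨v, hv, hv'⟩ := exists_cone_loop hY ha hlr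
    refine ⟨v, ?_, hv l (by omega), hv'⟩
    have h := (hasFan_two (hv 0 (by omega)) (hv 1 (by omega))).extend (l - 2)
      fun i _ hi => hv i (by omega)
    rw [show 2 + (l - 2) = l by omega] at h
    refine h.mono (by omega) (le_trans (by omega : _ ≤ 1 * (r - 1)) ?_)
    exact Nat.mul_le_mul_right _ (by omega)
  induction k with
  | zero =>
    intro a l hl ha hlr
    exact short 0 a l hl ha (by omega)
  | succ k ih =>
    intro a l hl ha hlr
    rcases le_or_gt (l + 2) r with h | h
    · exact short (k + 1) a l hl ha h
    -- The cone point `v` replaces the vertices after `a m`.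
    obtain ⟨m, rfl⟩ : ∃ m, l = m + (r - 3) := ⟨l - (r - 3), by omega⟩
    set U : Finset V := insert (a 0) ((Finset.Icc m (m + (r - 3) + 1)).image a) with hUdef
    have hU : U.card ≤ r := by
      refine (Finset.card_insert_le _ _).trans ?_
      have : ((Finset.Icc m (m + (r - 3) + 1)).image a).card ≤ _ := Finset.card_image_le
      rw [Nat.card_Icc] at this
      omega
    obtain ⟨v, hv⟩ := hY.exists_cone hU
    have hmU : ∀ i, m ≤ i → i ≤ m + (r - 3) + 1 → a i ∈ U := fun i h1 h2 =>
      Finset.mem_insert_of_mem (Finset.mem_image_of_mem a (Finset.mem_Icc.2 ⟨h1, h2⟩))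
    have h0U : a 0 ∈ U := Finset.mem_insert_self _ _
    have hedge : ∀ i, m ≤ i → i < m + (r - 3) + 1 → {v, a i, a (i + 1)} ∈ Y.faces := by
      intro i h1 h2
      refine hv _ (ha.1 i h2) ?_
      simp only [Finset.insert_subset_iff, Finset.singleton_subset_iff]
      exact ⟨hmU i h1 h2.le, hmU _ (by omega) h2⟩
    have hlast : {v, a (m + (r - 3) + 1), a 0} ∈ Y.faces := by
      refine hv _ ha.2 ?_
      simp only [Finset.insert_subset_iff, Finset.singleton_subset_iff]
      exact ⟨hmU _ (by omega) le_rfl, h0U⟩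
    have sub : ∀ {s t : Finset V}, s ∈ Y.faces → t.Nonempty → t ⊆ s → t ∈ Y.faces :=
      fun hs ht hts => (Y.isRelLowerSet_faces hs).2 hts ht
    set a' : ℕ → V := fun i => if i ≤ m then a i else v with ha'def
    have ha' : ∀ i ≤ m, a' i = a i := fun i hi => if_pos hi
    have ha'v : a' (m + 1) = v := if_neg (by omega)
    have hloop : IsEdgeLoop Y a' (m + 1) := by
      refine ⟨fun i hi => ?_, ?_⟩
      · rcases (Nat.lt_succ_iff.1 hi).lt_or_eq with h' | rfl
        · rw [ha' i h'.le, ha' (i + 1) h']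
          exact ha.1 i (by omega)
        · rw [ha' i le_rfl, ha'v]
          refine sub (hedge i le_rfl (by omega)) (Finset.insert_nonempty _ _) fun x hx => ?_
          simp only [Finset.mem_insert, Finset.mem_singleton] at hx ⊢
          tauto
      · rw [ha'v, ha' 0 (Nat.zero_le m)]
        refine sub hlast (Finset.insert_nonempty _ _) fun x hx => ?_
        simp only [Finset.mem_insert, Finset.mem_singleton] at hx ⊢
        tauto
    obtain ⟨u, hfan, hu1, hu2⟩ := ih a' m (by omega) hloop (by
      rw [Nat.succ_mul (k + 1)] at hlr
      omega)
    rw [ha'v] at hu1 hu2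
    refine ⟨v, ?_, hedge _ (by omega) (by omega), hlast⟩
    have h2 := ((hfan.cone hu1 hu2).congr ha').extend (r - 3) fun i h1 h2 =>
      hedge i h1 (by omega)
    refine h2.mono le_rfl ?_
    rw [Nat.succ_mul (k + 1)]
    omega

theorem exists_hasDisc (hr : 4 ≤ r) (hY : IsAmple r Y) {a : ℕ → V} {l : ℕ} (hl : 2 ≤ l)
    (ha : IsEdgeLoop Y a l) {k : ℕ} (hk : 1 ≤ k) (hlk : l + 1 ≤ 3 + k * (r - 3)) :
    HasDisc Y a l k (k * (r - 1) + 1) := by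
  obtain ⟨k, rfl⟩ : ∃ j, k = j + 1 := ⟨k - 1, by omega⟩
  rcases hl.eq_or_lt with rfl | hl
  · obtain ⟨v, hv, hv'⟩ := exists_cone_loop hY ha (by omega)
    refine (hasDisc_two (hv 0 (by omega)) (hv 1 (by omega)) hv').mono hk ?_
    have : 1 * (r - 1) ≤ (k + 1) * (r - 1) := Nat.mul_le_mul_right _ hk
    omega
  · obtain ⟨l, rfl⟩ : ∃ j, l = j + 1 := ⟨l - 1, by omega⟩
    obtain ⟨u, h, h1, h2⟩ := exists_hasFan hr hY k a l (by omega) ha hlk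
    exact h.close h1 h2

end Ample

/-! ### Loops and polygons indexed by residues -/

section Residues

variable {l : ℕ}

theorem val_add_one_of_ne {i : ZMod (l + 1)} (hi : i.val ≠ l) : (i + 1).val = i.val + 1 := by
  have h := i.val_lt
  have hi' : i + 1 = ((i.val + 1 : ℕ) : ZMod (l + 1)) := by
    rw [Nat.cast_add, ZMod.natCast_zmod_val, Nat.cast_one]
  rw [hi', ZMod.val_cast_of_lt (by omega)]

theorem add_one_of_val_eq {i : ZMod (l + 1)} (hi : i.val = l) : i + 1 = 0 := by
  rw [← ZMod.natCast_zmod_val i, hi]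
  exact_mod_cast ZMod.natCast_self (l + 1)

theorem mem_polygonEdges_iff {W : Type*} [DecidableEq W] {b : ℕ → W} {e : Finset W} :
    e ∈ polygonEdges l b ↔ ∃ i : ZMod (l + 1), e = {b i.val, b (i + 1).val} := by
  constructor
  · rintro (⟨i, hi, rfl⟩ | rfl)
    · have hv : ((i : ℕ) : ZMod (l + 1)).val = i := ZMod.val_cast_of_lt (by omega)
      refine ⟨i, ?_⟩
      rw [val_add_one_of_ne (by omega), hv]
    · have hv : ((l : ℕ) : ZMod (l + 1)).val = l := ZMod.val_cast_of_lt (by omega)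
      refine ⟨l, ?_⟩
      rw [add_one_of_val_eq hv, hv, ZMod.val_zero]
  · rintro ⟨i, rfl⟩
    by_cases hi : i.val = l
    · right
      rw [add_one_of_val_eq hi, hi, ZMod.val_zero]
    · left
      have := i.val_lt
      exact ⟨i.val, by omega, by rw [val_add_one_of_ne hi]⟩

theorem IsDisc.isDiscTriangulation {W : Type*} [Fintype W] [DecidableEq W]
    {D : AbstractSimplicialComplex W} {b : ℕ → W} (h : IsDisc D l b) :
    IsDiscTriangulation D (l + 1) fun i => b i.val := by
  obtain ⟨f, hf⟩ := h.exists_homeomorph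
  refine ⟨fun i j hij => ?_, fun i => h.edges_subset (mem_polygonEdges_iff.2 ⟨i, rfl⟩), f,
    fun x => (hf x).trans ?_⟩
  · have h1 := i.val_lt
    have h2 := j.val_lt
    exact ZMod.val_injective _ (h.injOn (Set.mem_Iic.2 (by omega)) (Set.mem_Iic.2 (by omega)) hij)
  · simp only [mem_polygonEdges_iff]
    constructor
    · rintro ⟨_, ⟨i, rfl⟩, hs⟩
      exact ⟨i, fun w hw => by simpa using hs (mem_supp.2 hw)⟩
    · rintro ⟨i, hi⟩
      exact ⟨_, ⟨i, rfl⟩, fun w hw => by simpa using hi w (mem_supp.1 hw)⟩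

theorem IsSimplicialLoop.isEdgeLoop {V : Type*} [DecidableEq V] {Y : AbstractSimplicialComplex V}
    {α : ZMod (l + 1) → V} (h : IsSimplicialLoop Y (l + 1) α) :
    IsEdgeLoop Y (fun i => α i) l := by
  refine ⟨fun i _ => by simpa using h.2 i, ?_⟩
  have := h.2 l
  rwa [show (l : ZMod (l + 1)) + 1 = 0 by exact_mod_cast ZMod.natCast_self (l + 1)] at this

theorem HasDisc.exists_boundsDisc {V : Type*} [DecidableEq V] {Y : AbstractSimplicialComplex V}
    {α : ZMod (l + 1) → V} {k t : ℕ} (h : HasDisc Y (fun i => α i) l k t) :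
    ∃ (W : Type) (_ : Fintype W) (_ : DecidableEq W) (D : AbstractSimplicialComplex W)
      (b : ZMod (l + 1) → W) (β : W → V), BoundsDisc Y (l + 1) α D b β ∧
        (internalVertices b).ncard ≤ k ∧ (triangles D).ncard ≤ t := by
  obtain ⟨W, i1, i2, D, b, β, h1, h2, h3, h4, h5⟩ := h
  have hd := h1.isDiscTriangulation
  refine ⟨W, i1, i2, D, _, β, ⟨hd, h2, fun i => ?_⟩, ?_, h5⟩
  · have := i.val_lt
    rw [h3 _ (by omega)]
    exact congrArg α (ZMod.natCast_zmod_val i)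
  · have e1 := Set.ncard_add_ncard_compl (Set.range fun i : ZMod (l + 1) => b i.val)
    have e2 : (Set.range fun i : ZMod (l + 1) => b i.val).ncard = l + 1 := by
      rw [← Set.image_univ, Set.ncard_image_of_injective _ hd.injective, Set.ncard_univ,
        Nat.card_zmod]
    rw [Nat.card_eq_fintype_card] at e1
    change (Set.range fun i : ZMod (l + 1) => b i.val)ᶜ.ncard ≤ k
    omega

end Residues

/-! ### The number of cone points -/

theorem le_three_add_mul_ceil {n r : ℕ} (hr : 4 ≤ r) :
    n ≤ 3 + max 1 ⌈((n : ℚ) - 3) / ((r : ℚ) - 3)⌉₊ * (r - 3) := by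
  set k := max 1 ⌈((n : ℚ) - 3) / ((r : ℚ) - 3)⌉₊ with hk
  have h1 : ((n : ℚ) - 3) / ((r : ℚ) - 3) ≤ k :=
    (Nat.le_ceil _).trans (Nat.cast_le.2 (le_max_right _ _))
  have h2 : (0 : ℚ) < (r : ℚ) - 3 := by
    have : (4 : ℚ) ≤ r := by exact_mod_cast hr
    linarith
  rw [div_le_iff₀ h2] at h1
  have h3 : (n : ℚ) ≤ ((3 + k * (r - 3) : ℕ) : ℚ) := by
    push_cast [Nat.cast_sub (by omega : 3 ≤ r)]
    linarith
  exact_mod_cast h3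

theorem IsAmple.exists_boundsDisc {V : Type*} [DecidableEq V] {Y : AbstractSimplicialComplex V}
    {r : ℕ} (hr : 4 ≤ r) (hY : IsAmple r Y) {n : ℕ} {α : ZMod n → V}
    (hα : IsSimplicialLoop Y n α) :
    ∃ (W : Type) (_ : Fintype W) (_ : DecidableEq W) (D : AbstractSimplicialComplex W)
      (b : ZMod n → W) (β : W → V), BoundsDisc Y n α D b β ∧
        (internalVertices b).ncard ≤ max 1 ⌈((n : ℚ) - 3) / ((r : ℚ) - 3)⌉₊ ∧
        (triangles D).ncard ≤ max 1 ⌈((n : ℚ) - 3) / ((r : ℚ) - 3)⌉₊ * (r - 1) + 1 := by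
  have hn := hα.1
  obtain ⟨l, rfl⟩ : ∃ l, n = l + 1 := ⟨n - 1, by omega⟩
  exact (exists_hasDisc hr hY (by omega) hα.isEdgeLoop (le_max_left _ _)
    (le_three_add_mul_ceil hr)).exists_boundsDisc

end AmpleComplex

theorem proposition4p1 {V : Type*} [DecidableEq V] (r : ℕ) (hr : 4 ≤ r)
    (Y : AbstractSimplicialComplex V) (hY : AmpleComplex.IsAmple r Y) :
    AmpleComplex.IsSimplyConnected Y ∧
    ∀ (n : ℕ) (α : ZMod n → V), AmpleComplex.IsSimplicialLoop Y n α →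
      ∃ (W : Type) (_ : Fintype W) (_ : DecidableEq W) (D : AbstractSimplicialComplex W)
        (b : ZMod n → W) (β : W → V),
        AmpleComplex.BoundsDisc Y n α D b β ∧
        (AmpleComplex.internalVertices b).ncard ≤ max 1 ⌈((n : ℚ) - 3) / ((r : ℚ) - 3)⌉₊ ∧
        (AmpleComplex.triangles D).ncard
          ≤ max 1 ⌈((n : ℚ) - 3) / ((r : ℚ) - 3)⌉₊ * (r - 1) + 1 := by
  refine ⟨⟨hY.2.1, fun u v => ?_, fun n α hα => ?_⟩, fun n α hα => hY.exists_boundsDisc hr hα⟩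
  · obtain ⟨w, hw⟩ := hY.exists_cone (U := {u, v}) (Finset.card_le_two.trans (by omega))
    have hu := hw {u} (Y.singleton_mem u) (by simp)
    have hv := hw {v} (Y.singleton_mem v) (by simp)
    refine ⟨2, fun i => if i = 0 then u else if i = 1 then w else v, rfl, rfl, fun i hi => ?_⟩
    interval_cases i
    · simpa [Finset.pair_comm] using hu
    · simpa using hv
  · obtain ⟨W, i1, i2, D, b, β, h, -⟩ := hY.exists_boundsDisc hr hα
    exact ⟨W, i1, i2, D, b, β, h⟩
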